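/- Let $K$ be a field of characteristic $0$ and let $z,u$ and $X=(X_1,X_2,X_3,\ldots)$ be independent indeterminates over $K$. For a partition $\mu$, let $|\mu|$ be its weight, $l(\mu)$ its length, $m_i(\mu)$ the multiplicity of the part $i$ in $\mu$, and $z_\mu=\prod_{i\ge1} i^{m_i(\mu)}\,m_i(\mu)!$. For an integer $r\ge 0$, let $\left\langle{\mu\atop r}\right\rangle$ be the number of ways to choose $r$ cells in the Ferrers diagram of $\mu$ such that at least one cell is chosen in each row (so it is $1$ for $\mu=\emptyset$, $r=0$). For integers $j,k\ge0$ put $$P_{jk}(X)=\sum_{|\mu|=j}\frac{\left\langle{\mu\atop k}\right\rangle}{z_\mu}\prod_{i\ge1}X_i^{m_i(\mu)},$$ the sum being over all partitions $\mu$ of $j$; in particular $P_{00}(X)=1$. Put $(i)_k=i(i+1)\cdots(i+k-1)$ and, for a polynomial $a$ and an integer $m\ge0$, $\binom{a}{m}=a(a-1)\cdots(a-m+1)/m!$; for integers $a\ge 0$ and $m<0$ put $\binom{a}{m}=0$. Then for all integers $n,r\ge1$ the following identity of formal power series in $u$ with coefficients in $K[z,X_1,X_2,\ldots]$ holds: $$\sum_{|\mu|=n}(-1)^{r-l(\mu)}\,\frac{\left\langle{\mu\atop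 r}\right\rangle}{z_\mu}\prod_{i\ge1}\Bigl(z+\sum_{k\ge1}u^k\,\frac{(i)_k}{k!}\,X_k\Bigr)^{m_i(\mu)}=\sum_{j\ge0}u^j\binom{n+j-1}{n-r}\left(\sum_{k=0}^{\min(r,j)}\binom{z-j}{r-k}P_{jk}(X)\right).$$ -/

import Mathlib

open scoped Nat PowerSeries

namespace PartitionIdentity

/-- The parts of a partition `μ`, in decreasing order. -/
def rows {n : ℕ} (μ : n.Partition) : List ℕ := μ.parts.sort (· ≥ ·)

/-- The Ferrers diagram of `μ`: the cells `(i, j)` where `i` is (the index of) a row of `μ`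
and `j` is one of the `μ_i` positions in this row. -/
abbrev Cell {n : ℕ} (μ : n.Partition) : Type :=
  (i : Fin (rows μ).length) × Fin ((rows μ).get i)

/-- The generalized binomial coefficient `⟨μ r⟩`: the number of ways to choose `r` cells in the
diagram of `μ` so that at least one cell is chosen in each row. -/
def bracket {n : ℕ} (μ : n.Partition) (r : ℕ) : ℕ :=
  Fintype.card {S : Finset (Cell μ) // S.card = r ∧ ∀ i, ∃ j, (⟨i, j⟩ : Cell μ) ∈ S}

/-- The length `l(μ)`. -/
def len {n : ℕ} (μ : n.Partition) : ℕ := μ.parts.card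

/-- The multiplicity `m_i(μ)` of `i` in `μ`. -/
def mult {n : ℕ} (μ : n.Partition) (i : ℕ) : ℕ := μ.parts.count i

/-- `z_μ = ∏_{i ≥ 1} i ^ m_i(μ) * m_i(μ)!`; the factors with `i > n` are equal to `1`. -/
def zee {n : ℕ} (μ : n.Partition) : ℕ :=
  ∏ i ∈ Finset.Icc 1 n, i ^ mult μ i * (mult μ i)!

/-- The binomial coefficient `a (a - 1) ⋯ (a - m + 1) / m!` of an element of a `K`-algebra. -/
noncomputable def binom (K : Type*) [Field K] {A : Type*} [CommRing A] [Algebra K A]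
    (a : A) (m : ℕ) : A :=
  ((m ! : K)⁻¹) • ∏ i ∈ Finset.range m, (a - (i : A))

/-- `P_{jk}(X) = ∑_{|μ| = j} ⟨μ k⟩ / z_μ * ∏_{i ≥ 1} X_i ^ m_i(μ)`.  The indeterminate `X_i` is
`MvPolynomial.X i` with `i ≥ 1`; the variable of index `0` does not occur. -/
noncomputable def P (K : Type*) [Field K] (j k : ℕ) : MvPolynomial ℕ K :=
  ∑ μ : j.Partition, ((bracket μ k : K) / (zee μ : K)) •
    ∏ i ∈ Finset.Icc 1 j, (MvPolynomial.X i : MvPolynomial ℕ K) ^ mult μ i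

/-- The ring of polynomials in `X_1, X_2, …` and `z` over `K`; the indeterminate `u` is the
variable of the power series ring `(Coeff K)⟦X⟧`. -/
abbrev Coeff (K : Type*) [Field K] : Type _ := Polynomial (MvPolynomial ℕ K)

/-- The indeterminate `z`. -/
noncomputable def zVar (K : Type*) [Field K] : Coeff K := Polynomial.X

/-- The indeterminate `X_k` (for `k ≥ 1`). -/
noncomputable def xVar (K : Type*) [Field K] (k : ℕ) : Coeff K :=
  Polynomial.C (MvPolynomial.X k)

/-- The formal power series `z + ∑_{k ≥ 1} u ^ k * (i)_k / k! * X_k` in `u`, where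
`(i)_k = i (i + 1) ⋯ (i + k - 1)`. -/
noncomputable def rowSeries (K : Type*) [Field K] (i : ℕ) : (Coeff K)⟦X⟧ :=
  PowerSeries.C (zVar K) + PowerSeries.mk fun k =>
    if 1 ≤ k then ((i.ascFactorial k : K) / (k ! : K)) • xVar K k else 0

/-- The usual binomial coefficient `C(a, b - c)`, which is zero when `b - c` is negative. -/
def natBinom (a b c : ℕ) : ℕ := if c ≤ b then a.choose (b - c) else 0

end PartitionIdentity

/-! Mark `n` by q and `r` by y. The left-hand sides are the coefficients of F = exp(∑_i c_i (1 -
(1-y)^i) q^i / i), where c_i = ∑_k u^k C(i+k-1, k) x_k, x_0 = z and x_k = X_k for k ≥ 1. The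
right-hand sides are, for n, r ≥ 1, those of G = ∑_j (u/(1-q))^j (1+s)^(z-j) B_j(s), where s =
qy/(1-q) and ∑_j B_j(s) t^j = exp(∑_i x_i ((1+s)^i - 1) t^i / i).

Both F and G solve ∂F/∂y = q ∑_k u^k x_k (1-q+qy)^(-k-1) F and equal 1 at y = 0, so they coincide.
Read coefficientwise in u, this is a triangular linear system: `derivative_rowFamily` and
`derivative_closedFamily` establish it for the two sides, `eq_of_derivative_eq_sum` gives
uniqueness, and `coeff_rowSum` extracts the coefficient of q^n y^r. -/

namespace PartitionIdentity

/-! ### Partitions as multisets, and the weight z_μ -/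

/-- The multisets of positive integers with sum `n`. -/
def partMultisets (n : ℕ) : Finset (Multiset ℕ) :=
  Finset.univ.image fun μ : n.Partition => μ.parts

theorem mem_partMultisets {n : ℕ} {s : Multiset ℕ} :
    s ∈ partMultisets n ↔ s.sum = n ∧ ∀ i ∈ s, 0 < i := by
  simp only [partMultisets, Finset.mem_image, Finset.mem_univ, true_and]
  constructor
  · rintro ⟨μ, rfl⟩
    exact ⟨μ.parts_sum, fun i hi => μ.parts_pos hi⟩
  · rintro ⟨h1, h2⟩
    exact ⟨⟨s, fun {i} hi => h2 i hi, h1⟩, rfl⟩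

theorem sum_partition_eq_sum_partMultisets {A : Type*} [AddCommMonoid A] (n : ℕ)
    (f : Multiset ℕ → A) : ∑ μ : n.Partition, f μ.parts = ∑ s ∈ partMultisets n, f s := by
  rw [partMultisets, Finset.sum_image]
  intro μ _ ν _ h
  exact Nat.Partition.ext h

/-- `∏ i ^ m_i * m_i!` for a multiset with multiplicities `m_i`. -/
def multisetZee (s : Multiset ℕ) : ℕ := ∏ i ∈ s.toFinset, i ^ s.count i * (s.count i)!

theorem toFinset_parts_subset {n : ℕ} (μ : n.Partition) :
    μ.parts.toFinset ⊆ Finset.Icc 1 n := by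
  intro i hi
  rw [Multiset.mem_toFinset] at hi
  exact Finset.mem_Icc.2 ⟨μ.parts_pos hi, μ.le_of_mem_parts hi⟩

theorem zee_eq_multisetZee {n : ℕ} (μ : n.Partition) : zee μ = multisetZee μ.parts := by
  symm
  refine Finset.prod_subset (toFinset_parts_subset μ) fun i _ hi => ?_
  rw [Multiset.mem_toFinset] at hi
  simp [Multiset.count_eq_zero_of_notMem hi]

theorem prod_pow_mult {A : Type*} [CommMonoid A] {n : ℕ} (μ : n.Partition) (a : ℕ → A) :
    ∏ i ∈ Finset.Icc 1 n, a i ^ mult μ i = (μ.parts.map a).prod := by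
  rw [Finset.prod_multiset_map_count]
  symm
  refine Finset.prod_subset (toFinset_parts_subset μ) fun i _ hi => ?_
  rw [Multiset.mem_toFinset] at hi
  simp [Multiset.count_eq_zero_of_notMem hi]

theorem multisetZee_cons (i : ℕ) (s : Multiset ℕ) :
    multisetZee (i ::ₘ s) = i * (s.count i + 1) * multisetZee s := by
  have key : ∀ (t : Multiset ℕ) (T : Finset ℕ), t.toFinset ⊆ T →
      multisetZee t = ∏ j ∈ T, j ^ t.count j * (t.count j)! := by
    intro t T h
    refine Finset.prod_subset h fun j _ hj => ?_
    rw [Multiset.mem_toFinset] at hj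
    simp [Multiset.count_eq_zero_of_notMem hj]
  have hi : i ∈ (i ::ₘ s).toFinset := by simp
  rw [key s (i ::ₘ s).toFinset (by simp), multisetZee,
    ← Finset.mul_prod_erase _ _ hi, ← Finset.mul_prod_erase _ _ hi, ← mul_assoc]
  congr 1
  · rw [Multiset.count_cons_self, pow_succ, Nat.factorial_succ]
    ring
  · refine Finset.prod_congr rfl fun j hj => ?_
    rw [Multiset.count_cons_of_ne (Finset.ne_of_mem_erase hj)]

/-! ### The exponential formula and its recurrences -/

section ExpSum

variable (K : Type*) [Field K] {A : Type*} [CommRing A] [Algebra K A]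

/-- The coefficient of `q ^ n` in `exp (∑ i, a i * q ^ i / i)`. -/
noncomputable def expSum (a : ℕ → A) (n : ℕ) : A :=
  ∑ μ : n.Partition, (zee μ : K)⁻¹ • (μ.parts.map a).prod

theorem expSum_eq (a : ℕ → A) (n : ℕ) :
    expSum K a n = ∑ s ∈ partMultisets n, (multisetZee s : K)⁻¹ • (s.map a).prod := by
  rw [← sum_partition_eq_sum_partMultisets n
    fun s => (multisetZee s : K)⁻¹ • (s.map a).prod]
  simp only [expSum, zee_eq_multisetZee]

theorem expSum_zero (a : ℕ → A) : expSum K a 0 = 1 := by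
  have : partMultisets 0 = {0} := by
    ext s
    rw [mem_partMultisets, Finset.mem_singleton]
    constructor
    · rintro ⟨h1, h2⟩
      refine Multiset.eq_zero_of_forall_notMem fun i hi => ?_
      have := Multiset.le_sum_of_mem hi
      have := h2 i hi
      omega
    · rintro rfl
      simp
  rw [expSum_eq, this]
  simp [multisetZee]

/-- Removing one part from every partition of `n + 1`. -/
theorem sum_erase_part [CharZero K] (a b : ℕ → A) (n : ℕ) :
    ∑ s ∈ partMultisets (n + 1), (multisetZee s : K)⁻¹ •
        (s.map fun i => ((s.erase i).map a).prod * b i).sum =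
      ∑ p ∈ Finset.HasAntidiagonal.antidiagonal n, ((p.1 + 1 : ℕ) : K)⁻¹ • (b (p.1 + 1) * expSum K a p.2) := by
  have h1 : ∀ s : Multiset ℕ, (multisetZee s : K)⁻¹ •
        (s.map fun i => ((s.erase i).map a).prod * b i).sum =
      ∑ i ∈ s.toFinset, ((multisetZee s : K)⁻¹ * s.count i) •
        (((s.erase i).map a).prod * b i) := by
    intro s
    rw [Finset.sum_multiset_map_count, Finset.smul_sum]
    refine Finset.sum_congr rfl fun i _ => ?_
    rw [mul_smul, Nat.cast_smul_eq_nsmul]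
  simp only [h1, expSum_eq, Finset.mul_sum, Finset.smul_sum]
  rw [Finset.sum_sigma', Finset.sum_sigma']
  -- A partition with a distinguished part size i corresponds to i and the partition of n + 1 - i
  -- left after deleting one i. By `multisetZee_cons` the multiplicity of i cancels, leaving the
  -- weight 1/i.
  refine Finset.sum_bij' (fun x _ => ⟨(x.2 - 1, n + 1 - x.2), x.1.erase x.2⟩)
    (fun y _ => ⟨(y.1.1 + 1) ::ₘ y.2, y.1.1 + 1⟩) ?_ ?_ ?_ ?_ ?_
  · rintro ⟨s, i⟩ h
    simp only [Finset.mem_sigma, mem_partMultisets, Multiset.mem_toFinset,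
      Finset.HasAntidiagonal.mem_antidiagonal] at h ⊢
    obtain ⟨⟨hs, hp⟩, hi⟩ := h
    have := hp i hi
    have hc := Multiset.sum_erase hi
    exact ⟨by omega, by omega, fun j hj => hp j (Multiset.mem_of_mem_erase hj)⟩
  · rintro ⟨⟨p, q⟩, s⟩ h
    simp only [Finset.mem_sigma, mem_partMultisets, Multiset.mem_toFinset,
      Finset.HasAntidiagonal.mem_antidiagonal, Multiset.sum_cons, Multiset.mem_cons] at h ⊢
    obtain ⟨hpq, hs, hp⟩ := h
    refine ⟨⟨by omega, ?_⟩, by simp⟩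
    rintro i (rfl | hi)
    · omega
    · exact hp i hi
  · rintro ⟨s, i⟩ h
    simp only [Finset.mem_sigma, mem_partMultisets, Multiset.mem_toFinset] at h
    obtain ⟨⟨hs, hp⟩, hi⟩ := h
    have := hp i hi
    have h2 : i - 1 + 1 = i := by omega
    simp [h2, Multiset.cons_erase hi]
  · rintro ⟨⟨p, q⟩, s⟩ h
    simp only [Finset.mem_sigma, mem_partMultisets, Finset.HasAntidiagonal.mem_antidiagonal] at h
    have : n + 1 - (p + 1) = q := by omega
    simp [this]
  · rintro ⟨s, i⟩ h
    simp only [Finset.mem_sigma, mem_partMultisets, Multiset.mem_toFinset] at h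
    obtain ⟨⟨hs, hp⟩, hi⟩ := h
    have h0 := hp i hi
    have h2 : i - 1 + 1 = i := by omega
    obtain ⟨t, rfl⟩ := Multiset.exists_cons_of_mem hi
    have hK : ((t.count i : K) + 1) ≠ 0 := Nat.cast_add_one_ne_zero _
    simp only [h2, Multiset.erase_cons_head, mul_smul_comm, smul_smul]
    rw [mul_comm (b i), multisetZee_cons, Multiset.count_cons_self]
    congr 1
    push_cast
    rw [mul_inv, mul_inv]
    field_simp

theorem derivation_multiset_prod (d : Derivation K A A) (a : ℕ → A) (s : Multiset ℕ) :
    d (s.map a).prod = (s.map fun i => ((s.erase i).map a).prod * d (a i)).sum := by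
  induction s using Multiset.induction_on with
  | empty => simp
  | cons c t ih =>
    have h : t.map (fun i => ((((c ::ₘ t).erase i).map a).prod * d (a i))) =
        t.map (fun i => a c * (((t.erase i).map a).prod * d (a i))) := by
      refine Multiset.map_congr rfl fun i hi => ?_
      rw [Multiset.erase_cons_tail_of_mem hi, Multiset.map_cons, Multiset.prod_cons, mul_assoc]
    rw [Multiset.map_cons, Multiset.prod_cons, Derivation.leibniz, ih, Multiset.map_cons,
      Multiset.sum_cons, h, Multiset.sum_map_mul_left, Multiset.erase_cons_head, smul_eq_mul,
      smul_eq_mul, add_comm]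

/-- The case of `sum_erase_part` in which `b i = i * e i`. -/
theorem sum_erase_part_natCast_mul [CharZero K] (a e : ℕ → A) (n : ℕ) :
    ∑ s ∈ partMultisets (n + 1), (multisetZee s : K)⁻¹ •
        (s.map fun i => ((s.erase i).map a).prod * ((i : A) * e i)).sum =
      ∑ p ∈ Finset.HasAntidiagonal.antidiagonal n, e (p.1 + 1) * expSum K a p.2 := by
  rw [sum_erase_part K a fun i => (i : A) * e i]
  refine Finset.sum_congr rfl fun p _ => ?_
  have hK : ((p.1 + 1 : ℕ) : K) ≠ 0 := Nat.cast_ne_zero.2 (Nat.succ_ne_zero _)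
  rw [mul_assoc, ← nsmul_eq_mul, ← Nat.cast_smul_eq_nsmul K, smul_smul, inv_mul_cancel₀ hK,
    one_smul]

/-- With E = exp(∑ a_i q^i / i), this is dE = (∑ e_i q^i) E: the factor i in d(a_i) cancels the
denominator. -/
theorem derivation_expSum [CharZero K] (d : Derivation K A A) (a e : ℕ → A)
    (h : ∀ i, d (a i) = i * e i) (n : ℕ) :
    d (expSum K a (n + 1)) =
      ∑ p ∈ Finset.HasAntidiagonal.antidiagonal n, e (p.1 + 1) * expSum K a p.2 := by
  rw [← sum_erase_part_natCast_mul, expSum_eq, map_sum]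
  refine Finset.sum_congr rfl fun s _ => ?_
  simp only [Derivation.map_smul, derivation_multiset_prod, h]

/-- The Euler operator q d/dq applied to the exponential. Combinatorially, n + 1 is the sum of the
parts, and each part is removed in turn. -/
theorem succ_mul_expSum [CharZero K] (a : ℕ → A) (n : ℕ) :
    ((n + 1 : ℕ) : A) * expSum K a (n + 1) =
      ∑ p ∈ Finset.HasAntidiagonal.antidiagonal n, a (p.1 + 1) * expSum K a p.2 := by
  rw [← sum_erase_part_natCast_mul, expSum_eq, Finset.mul_sum]
  refine Finset.sum_congr rfl fun s hs => ?_
  rw [mul_smul_comm]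
  congr 1
  rw [← (mem_partMultisets.1 hs).1, Nat.cast_multiset_sum, ← Multiset.sum_map_mul_right]
  congr 1
  refine Multiset.map_congr rfl fun i hi => ?_
  rw [mul_left_comm, mul_comm _ (a i), Multiset.prod_map_erase hi]

end ExpSum

/-! ### The generating function of the cell choices -/

theorem card_finset_sigma {ι : Type*} [Fintype ι] [DecidableEq ι] (α : ι → Type*)
    [∀ i, Fintype (α i)] [∀ i, DecidableEq (α i)] (r : ℕ) :
    Fintype.card {S : Finset (Σ i, α i) // S.card = r ∧ ∀ i, ∃ j, (⟨i, j⟩ : Σ i, α i) ∈ S} =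
      Fintype.card {p : ∀ i, Finset (α i) // ∑ i, (p i).card = r ∧ ∀ i, (p i).Nonempty} := by
  have h : ∀ S : Finset (Σ i, α i),
      Finset.univ.sigma (fun i => Finset.univ.filter fun j => (⟨i, j⟩ : Σ i, α i) ∈ S) = S := by
    intro S
    ext ⟨i, j⟩
    simp
  let e : Finset (Σ i, α i) ≃ ∀ i, Finset (α i) :=
    { toFun := fun S i => Finset.univ.filter fun j => (⟨i, j⟩ : Σ i, α i) ∈ S
      invFun := fun p => Finset.univ.sigma p
      left_inv := h
      right_inv := fun p => by
        ext i j
        simp }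
  refine Fintype.card_congr (e.subtypeEquiv fun S => ?_)
  have hc : S.card = ∑ i, (e S i).card := by
    rw [← Finset.card_sigma]
    exact congrArg Finset.card (h S).symm
  rw [hc]
  refine and_congr Iff.rfl (forall_congr' fun i => ?_)
  simp [e, Finset.Nonempty]

theorem one_add_pow_card_sub_one {A : Type*} [CommRing A] (x : A) (β : Type*) [Fintype β] :
    (1 + x) ^ Fintype.card β - 1 =
      ∑ s ∈ (Finset.univ : Finset (Finset β)).filter Finset.Nonempty, x ^ s.card := by
  classical
  have h := Fintype.sum_pow_mul_eq_add_pow β x 1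
  simp only [one_pow, mul_one] at h
  rw [add_comm, ← h, ← Finset.sum_filter_add_sum_filter_not Finset.univ Finset.Nonempty]
  have h2 : (Finset.univ : Finset (Finset β)).filter (fun s => ¬ s.Nonempty) = {∅} := by
    ext s
    simp [Finset.not_nonempty_iff_eq_empty]
  rw [h2]
  simp

/-- Rows are chosen independently, and the nonempty subsets of a row of length i, counted by size,
have generating polynomial (1+X)^i - 1. -/
theorem coeff_prod_one_add_X_pow_sub_one {R : Type*} [CommRing R] {n : ℕ} (μ : n.Partition)
    (r : ℕ) :
    PowerSeries.coeff r (μ.parts.map fun i => (1 + PowerSeries.X : R⟦X⟧) ^ i - 1).prod =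
      (bracket μ r : R) := by
  have h1 : (μ.parts.map fun i => (1 + PowerSeries.X : R⟦X⟧) ^ i - 1).prod =
      ∏ i : Fin (rows μ).length, ((1 + PowerSeries.X : R⟦X⟧) ^ (rows μ).get i - 1) := by
    have h2 : μ.parts = (rows μ : Multiset ℕ) := (Multiset.sort_eq _ _).symm
    rw [h2, Multiset.map_coe, Multiset.prod_coe, ← Fin.prod_univ_fun_getElem]
    rfl
  have h3 : ∀ i : Fin (rows μ).length, ((1 + PowerSeries.X : R⟦X⟧) ^ (rows μ).get i - 1) =
      ∑ s ∈ (Finset.univ : Finset (Finset (Fin ((rows μ).get i)))).filter Finset.Nonempty,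
        PowerSeries.X ^ s.card := by
    intro i
    rw [← one_add_pow_card_sub_one, Fintype.card_fin]
  rw [h1, Finset.prod_congr rfl fun i _ => h3 i, Finset.prod_univ_sum, map_sum]
  simp only [Finset.prod_pow_eq_pow_sum, PowerSeries.coeff_X_pow]
  rw [← Finset.sum_filter_add_sum_filter_not _ (fun p => r = ∑ i, (p i).card),
    Finset.sum_congr rfl fun p hp => if_pos (Finset.mem_filter.1 hp).2,
    Finset.sum_congr rfl fun p hp => if_neg (Finset.mem_filter.1 hp).2]
  simp only [Finset.sum_const, nsmul_eq_mul, mul_one, mul_zero, add_zero]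
  have hb : bracket μ r = Fintype.card {p : ∀ i : Fin (rows μ).length,
      Finset (Fin ((rows μ).get i)) // ∑ i, (p i).card = r ∧ ∀ i, (p i).Nonempty} := by
    rw [bracket]
    convert card_finset_sigma (fun i : Fin (rows μ).length => Fin ((rows μ).get i)) r
  rw [hb, Fintype.card_subtype]
  congr 2
  ext p
  simp [Fintype.mem_piFinset, and_comm, eq_comm]

end PartitionIdentity
-- The left-hand side: its differential system in y
namespace PartitionIdentity

open PowerSeries in
theorem coeff_one_sub_X_pow {R : Type*} [CommRing R] (p b : ℕ) :
    coeff b ((1 - X : R⟦X⟧) ^ p) = (-1) ^ b * (p.choose b : R) := by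
  have h : (1 - X : R⟦X⟧) ^ p = rescale (-1) ((1 + X) ^ p) := by
    simp [sub_eq_add_neg]
  have h2 : (1 + X : R⟦X⟧) ^ p = ((1 + Polynomial.X : Polynomial R) ^ p : Polynomial R) := by
    simp
  rw [h, coeff_rescale, h2, Polynomial.coeff_coe, Polynomial.coeff_one_add_X_pow]

section PowerSeriesFamilies

open PowerSeries

/-- A triangular system of linear differential equations has at most one solution with given
constant coefficients. -/
theorem eq_of_derivative_eq_sum {Λ : Type*} [CommRing Λ]
    (hΛ : ∀ (n : ℕ) (a b : Λ), a * ((n : Λ) + 1) = b * ((n : Λ) + 1) → a = b)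
    (M Y Z : ℕ → Λ⟦X⟧)
    (hY : ∀ j, d⁄dX Λ (Y j) = ∑ p ∈ Finset.HasAntidiagonal.antidiagonal j, M p.1 * Y p.2)
    (hZ : ∀ j, d⁄dX Λ (Z j) = ∑ p ∈ Finset.HasAntidiagonal.antidiagonal j, M p.1 * Z p.2)
    (h0 : ∀ j, coeff 0 (Y j) = coeff 0 (Z j)) : Y = Z := by
  have key : ∀ r j, coeff r (Y j) = coeff r (Z j) := by
    intro r
    induction r using Nat.strong_induction_on with
    | _ r ih =>
      intro j
      cases r with
      | zero => exact h0 j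
      | succ r =>
        -- Coefficient r of the derivative is (r+1) times coefficient r+1, and on the right only
        -- coefficients of index at most r occur.
        apply hΛ r
        rw [← coeff_derivative, ← coeff_derivative, hY, hZ, map_sum, map_sum]
        refine Finset.sum_congr rfl fun p _ => ?_
        rw [coeff_mul, coeff_mul]
        refine Finset.sum_congr rfl fun q hq => ?_
        rw [ih q.2 (Nat.lt_succ_of_le (Finset.HasAntidiagonal.antidiagonal.snd_le hq))]
  funext j
  exact PowerSeries.ext fun r => key r j

variable (K : Type*) [Field K] [CharZero K] {R : Type*} [CommRing R] [Algebra K R]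

-- `R` may have zero divisors, but n + 1 is the image of a nonzero scalar of `K`, hence a unit.
include K in
theorem mul_natCast_add_one_cancel (n : ℕ) (a b : R)
    (h : a * ((n : R) + 1) = b * ((n : R) + 1)) : a = b := by
  have hK : (n : K) + 1 ≠ 0 := Nat.cast_add_one_ne_zero n
  have h1 : ((n : R) + 1) * algebraMap K R ((n : K) + 1)⁻¹ = 1 := by
    have : ((n : R) + 1) = algebraMap K R ((n : K) + 1) := by simp
    rw [this, ← map_mul, mul_inv_cancel₀ hK, map_one]
  calc a = a * ((n : R) + 1) * algebraMap K R ((n : K) + 1)⁻¹ := by rw [mul_assoc, h1, mul_one]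
    _ = b := by rw [h, mul_assoc, h1, mul_one]

include K in
theorem powerSeries_mul_natCast_add_one_cancel (n : ℕ) (a b : R⟦X⟧)
    (h : a * ((n : R⟦X⟧) + 1) = b * ((n : R⟦X⟧) + 1)) : a = b := by
  have h1 : ((n : R⟦X⟧) + 1) = C ((n : R) + 1) := by simp
  ext m
  apply mul_natCast_add_one_cancel K n
  rw [← coeff_mul_C, ← coeff_mul_C, ← h1, h]

theorem constantCoeff_expSum_succ (a : ℕ → R⟦X⟧) (ha : ∀ i, constantCoeff (a i) = 0) (n : ℕ) :
    constantCoeff (expSum K a (n + 1)) = 0 := by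
  apply mul_natCast_add_one_cancel K n
  have h := congrArg constantCoeff (succ_mul_expSum K a n)
  simp only [map_mul, map_sum, ha, zero_mul, Finset.sum_const_zero] at h
  rw [zero_mul, mul_comm, ← h]
  simp

/-- The coefficient of `q ^ n` in `exp (∑ i, c i * (1 - (1 - y) ^ i) * q ^ i / i)`, as a power
series in `y`. -/
noncomputable def rowSum (c : ℕ → R) (n : ℕ) : R⟦X⟧ :=
  expSum K (fun i => C (c i) * (1 - (1 - X) ^ i)) n

theorem derivative_rowSum_succ (c : ℕ → R) (n : ℕ) :
    d⁄dX R (rowSum K c (n + 1)) = ∑ p ∈ Finset.HasAntidiagonal.antidiagonal n,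
      C (c (p.1 + 1)) * (1 - X) ^ p.1 * rowSum K c p.2 := by
  refine derivation_expSum K ((d⁄dX R).restrictScalars K)
    (fun i => C (c i) * (1 - (1 - X) ^ i)) (fun i => C (c i) * (1 - X) ^ (i - 1)) (fun i => ?_) n
  change d⁄dX R _ = _
  simp [Derivation.leibniz, Derivation.leibniz_pow]
  ring

theorem coeff_rowSum_succ (c : ℕ → R) (n r : ℕ) :
    coeff (r + 1) (rowSum K c (n + 1)) * ((r : R) + 1) =
      ∑ p ∈ Finset.HasAntidiagonal.antidiagonal n, ∑ b ∈ Finset.HasAntidiagonal.antidiagonal r,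
        c (p.1 + 1) * ((-1) ^ b.1 * (p.1.choose b.1 : R) * coeff b.2 (rowSum K c p.2)) := by
  rw [← coeff_derivative, derivative_rowSum_succ, map_sum]
  refine Finset.sum_congr rfl fun p _ => ?_
  rw [mul_assoc, coeff_C_mul, coeff_mul, Finset.mul_sum]
  simp only [coeff_one_sub_X_pow]

/-- The series `∑ k, u ^ k * (i)_k / k! * x k` in `u`, for `i ≥ 1`. -/
noncomputable def ascSeries (x : ℕ → R) (i : ℕ) : R⟦X⟧ :=
  mk fun k => ((i - 1 + k).choose k : R) * x k

/-- The coefficient of `u ^ j` in `∑ n, q ^ n * rowSum n`, as a power series in `y` whose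
coefficients are power series in `q`. -/
noncomputable def rowFamily (x : ℕ → R) (j : ℕ) : R⟦X⟧⟦X⟧ :=
  mk fun r => mk fun n => coeff j (coeff r (rowSum K (ascSeries x) n))

/-- The series `(1 - q + q * y) ^ (-k - 1)`. -/
noncomputable def invDenomPow (R : Type*) [CommRing R] (k : ℕ) : R⟦X⟧⟦X⟧ :=
  mk fun b => mk fun a => (-1) ^ b * (a.choose b : R) * ((a + k).choose k : R)

/-- Rests on ∑_{i≥1} C(i-1+k, k) q^i (1-y)^(i-1) = q (1-q+qy)^(-k-1), the factor multiplying u^k x_k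
in ∂F/∂y. -/
theorem derivative_rowFamily (x : ℕ → R) (j : ℕ) :
    d⁄dX R⟦X⟧ (rowFamily K x j) = ∑ p ∈ Finset.HasAntidiagonal.antidiagonal j,
      (C X * C (C (x p.1)) * invDenomPow R p.1) * rowFamily K x p.2 := by
  ext r n
  rw [coeff_derivative]
  have h1 : ((r : R⟦X⟧) + 1) = C ((r : R) + 1) := by simp
  rw [h1, coeff_mul_C, rowFamily, coeff_mk, coeff_mk]
  simp only [mul_assoc, map_sum, coeff_C_mul]
  -- At q^0 the left side vanishes because `rowSum` is the constant 1, the right side because of its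
  -- factor q.
  cases n with
  | zero =>
    simp [rowSum, expSum_zero, coeff_one]
  | succ n =>
    have h3 := congrArg (coeff j) (coeff_rowSum_succ K (ascSeries x) n r)
    rw [h1, coeff_mul_C] at h3
    have h4 : ∀ p b : ℕ × ℕ, coeff j (ascSeries x (p.1 + 1) * ((-1) ^ b.1 *
        ((p.1.choose b.1 : R⟦X⟧) * coeff b.2 (rowSum K (ascSeries x) p.2)))) =
        ∑ k ∈ Finset.HasAntidiagonal.antidiagonal j, x k.1 *
          ((-1) ^ b.1 * (p.1.choose b.1 : R) * ((p.1 + k.1).choose k.1 : R) *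
            coeff k.2 (coeff b.2 (rowSum K (ascSeries x) p.2))) := by
      intro p b
      have h5 : (-1 : R⟦X⟧) ^ b.1 * (p.1.choose b.1 : R⟦X⟧) =
        C ((-1) ^ b.1 * (p.1.choose b.1 : R)) := by simp
      rw [← mul_assoc ((-1 : R⟦X⟧) ^ b.1), h5, mul_left_comm, coeff_C_mul, coeff_mul,
        Finset.mul_sum]
      refine Finset.sum_congr rfl fun k _ => ?_
      rw [ascSeries, coeff_mk, Nat.add_sub_cancel]
      ring
    simp only [map_sum, mul_assoc] at h3 h4
    simp only [h4] at h3
    rw [h3]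
    simp only [coeff_succ_X_mul, coeff_C_mul]
    simp only [coeff_mul, map_sum, invDenomPow, coeff_mk, Finset.mul_sum, mul_assoc]
    rw [Finset.sum_comm, Finset.sum_comm (s := Finset.HasAntidiagonal.antidiagonal j)]
    refine Finset.sum_congr rfl fun b _ => ?_
    rw [Finset.sum_comm]
    simp only [rowFamily, coeff_mk]

theorem coeff_zero_rowFamily (x : ℕ → R) (j : ℕ) :
    coeff 0 (rowFamily K x j) = if j = 0 then 1 else 0 := by
  ext n
  rw [rowFamily, coeff_mk, coeff_mk]
  cases n with
  | zero =>
    by_cases hj : j = 0 <;> simp [rowSum, expSum_zero, coeff_one, hj]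
  | succ n =>
    rw [coeff_zero_eq_constantCoeff_apply, rowSum, constantCoeff_expSum_succ]
    · by_cases hj : j = 0 <;> simp [coeff_one, hj]
    · simp

end PowerSeriesFamilies
end PartitionIdentity
namespace PartitionIdentity

/-! ### The right-hand side: its differential system, and equality -/

section BinomialSide

open PowerSeries

variable (K : Type*) [Field K] [CharZero K] {R : Type*} [CommRing R] [Algebra K R]

theorem binom_succ_mul (a : R) (m : ℕ) :
    binom K a (m + 1) * ((m : R) + 1) = (a - m) * binom K a m := by
  have hK : (m : K) + 1 ≠ 0 := Nat.cast_add_one_ne_zero m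
  have h1 : ((m : R) + 1) = algebraMap K R ((m : K) + 1) := by simp
  rw [binom, binom, h1, mul_comm, ← Algebra.smul_def, smul_smul, Finset.prod_range_succ,
    mul_smul_comm, mul_comm (a - _)]
  congr 1
  rw [Nat.factorial_succ]
  push_cast
  rw [mul_inv, ← mul_assoc, mul_inv_cancel₀ hK, one_mul]

omit [CharZero K] in
theorem binom_zero (a : R) : binom K a 0 = 1 := by
  simp [binom]

theorem prod_range_succ_add_one_sub (a : R) (m : ℕ) :
    ∏ i ∈ Finset.range (m + 1), (a + 1 - (i : R)) =
      (a + 1) * ∏ i ∈ Finset.range m, (a - (i : R)) := by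
  rw [Finset.prod_range_succ', mul_comm]
  simp [add_sub_add_right_eq_sub]

theorem binom_add_one_succ (a : R) (m : ℕ) :
    binom K (a + 1) (m + 1) = binom K a (m + 1) + binom K a m := by
  apply mul_natCast_add_one_cancel K m
  have h1 : binom K (a + 1) (m + 1) * ((m : R) + 1) = (a + 1) * binom K a m := by
    have hK : (m : K) + 1 ≠ 0 := Nat.cast_add_one_ne_zero m
    have h1 : ((m : R) + 1) = algebraMap K R ((m : K) + 1) := by simp
    rw [binom, binom, h1, mul_comm, ← Algebra.smul_def, smul_smul, prod_range_succ_add_one_sub,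
      mul_smul_comm]
    congr 1
    rw [Nat.factorial_succ]
    push_cast
    rw [mul_inv, ← mul_assoc, mul_inv_cancel₀ hK, one_mul]
  rw [h1, add_mul (binom K a (m + 1)), binom_succ_mul]
  ring

/-- The binomial series `(1 + s) ^ a`. -/
noncomputable def binomSeries (a : R) : R⟦X⟧ := mk fun m => binom K a m

theorem derivative_binomSeries (a : R) :
    (1 + X) * d⁄dX R (binomSeries K a) = C a * binomSeries K a := by
  ext m
  rw [add_mul, one_mul, map_add, coeff_C_mul]
  cases m with
  | zero =>
    rw [coeff_zero_X_mul, coeff_derivative]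
    simpa [binomSeries] using binom_succ_mul K a 0
  | succ m =>
    rw [coeff_succ_X_mul, coeff_derivative, coeff_derivative, binomSeries, coeff_mk, coeff_mk,
      binom_succ_mul]
    push_cast
    ring

theorem one_add_X_mul_binomSeries (a : R) :
    (1 + X) * binomSeries K a = binomSeries K (a + 1) := by
  ext m
  rw [add_mul, one_mul, map_add]
  cases m with
  | zero => simp [binomSeries, binom_zero]
  | succ m =>
    rw [coeff_succ_X_mul, binomSeries, binomSeries, coeff_mk, coeff_mk, coeff_mk,
      binom_add_one_succ]

theorem one_add_X_pow_mul_binomSeries (a : R) (k : ℕ) :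
    (1 + X) ^ k * binomSeries K a = binomSeries K (a + k) := by
  induction k with
  | zero => simp
  | succ k ih =>
    rw [pow_succ', mul_assoc, ih, one_add_X_mul_binomSeries]
    push_cast
    rw [add_assoc]

/-- The coefficient of `t ^ j` in `exp (∑ i, x i * ((1 + s) ^ i - 1) * t ^ i / i)`. -/
noncomputable def bracketSeries (x : ℕ → R) (j : ℕ) : R⟦X⟧ :=
  expSum K (fun i => C (x i) * ((1 + X) ^ i - 1)) j

/-- Differentiation gives (1+s) B_j' = ∑ x_i (1+s)^i B_{j-i}. The Euler recurrence for j B_j has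
(1+s)^i - 1 in place of (1+s)^i, so the difference is ∑ x_i B_{j-i}. -/
theorem derivative_bracketSeries_succ (x : ℕ → R) (n : ℕ) :
    (1 + X) * d⁄dX R (bracketSeries K x (n + 1)) =
      ((n + 1 : ℕ) : R⟦X⟧) * bracketSeries K x (n + 1) +
        ∑ p ∈ Finset.HasAntidiagonal.antidiagonal n, C (x (p.1 + 1)) * bracketSeries K x p.2 := by
  have h : d⁄dX R (bracketSeries K x (n + 1)) =
      ∑ p ∈ Finset.HasAntidiagonal.antidiagonal n,
        C (x (p.1 + 1)) * (1 + X) ^ p.1 * bracketSeries K x p.2 := by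
    refine derivation_expSum K ((d⁄dX R).restrictScalars K)
      (fun i => C (x i) * ((1 + X) ^ i - 1)) (fun i => C (x i) * (1 + X) ^ (i - 1))
      (fun i => ?_) n
    change d⁄dX R _ = _
    simp [Derivation.leibniz, Derivation.leibniz_pow]
    ring
  rw [h, bracketSeries, succ_mul_expSum, Finset.mul_sum, ← Finset.sum_add_distrib]
  refine Finset.sum_congr rfl fun p _ => ?_
  rw [bracketSeries, pow_succ]
  ring

/-- The series `(1 + s) ^ (x 0 - j)` times the coefficient of `t ^ j` in
`exp (∑ i, x i * ((1 + s) ^ i - 1) * t ^ i / i)`. -/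
noncomputable def binomBracket (x : ℕ → R) (j : ℕ) : R⟦X⟧ :=
  binomSeries K (x 0 - j) * bracketSeries K x j

/-- The exponent x_0 - j is chosen so that its -j cancels the term j B_j; the remaining x_0 B_j
becomes the term of index 0 in the sum. -/
theorem derivative_binomBracket (x : ℕ → R) (j : ℕ) :
    (1 + X) * d⁄dX R (binomBracket K x j) = ∑ p ∈ Finset.HasAntidiagonal.antidiagonal j,
      C (x p.1) * (binomSeries K (x 0 - j) * bracketSeries K x p.2) := by
  have h := derivative_binomSeries K (x 0 - (j : R))
  have h1 : (1 + X) * d⁄dX R (binomBracket K x j) =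
      binomSeries K (x 0 - j) * ((1 + X) * d⁄dX R (bracketSeries K x j)) +
        bracketSeries K x j * ((1 + X) * d⁄dX R (binomSeries K (x 0 - (j : R)))) := by
    rw [binomBracket, Derivation.leibniz, smul_eq_mul, smul_eq_mul]
    ring
  rw [h1, h]
  cases j with
  | zero => simp [bracketSeries, expSum_zero]
  | succ n =>
    rw [derivative_bracketSeries_succ, Finset.Nat.sum_antidiagonal_succ]
    simp only [mul_left_comm (C _) (binomSeries K _), ← Finset.mul_sum]
    simp only [map_sub, map_natCast]
    ring

/-- The substitution `s = q * y / (1 - q)`. -/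
noncomputable def geomSubst (R : Type*) [CommRing R] : R⟦X⟧ →+* R⟦X⟧⟦X⟧ :=
  (rescale (X * mk 1 : R⟦X⟧)).comp (map C)

theorem coeff_geomSubst (f : R⟦X⟧) (r : ℕ) :
    coeff r (geomSubst R f) = (X * mk 1 : R⟦X⟧) ^ r * C (coeff r f) := by
  simp [geomSubst]

theorem derivative_geomSubst (f : R⟦X⟧) :
    d⁄dX R⟦X⟧ (geomSubst R f) = C (X * mk 1 : R⟦X⟧) * geomSubst R (d⁄dX R f) := by
  ext1 r
  rw [coeff_derivative, coeff_C_mul, coeff_geomSubst, coeff_geomSubst, coeff_derivative, map_mul]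
  simp
  ring

/-- The series `1 - q + q * y`. -/
noncomputable def denom (R : Type*) [CommRing R] : R⟦X⟧⟦X⟧ := 1 - C X + C X * X

theorem denom_eq : denom R = C (1 - X) * geomSubst R (1 + X) := by
  have h : geomSubst R (1 + X) = 1 + C (X * mk 1) * X := by
    simp [geomSubst]
  have h2 : (C (1 - X) : R⟦X⟧⟦X⟧) * C (X * mk 1) = C X := by
    rw [← map_mul, mul_left_comm, mul_comm (1 - X), mk_one_mul_one_sub_eq_one, mul_one]
  rw [h, mul_add, ← mul_assoc, h2, denom]
  simp

theorem coeff_coeff_invDenomPow (k b a : ℕ) : coeff a (coeff b (invDenomPow R k)) =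
    (-1) ^ b * (a.choose b : R) * ((a + k).choose k : R) := by
  rw [invDenomPow, coeff_mk, coeff_mk]

theorem coeff_zero_coeff_mul_denom (f : R⟦X⟧⟦X⟧) (b : ℕ) :
    coeff 0 (coeff b (f * denom R)) = coeff 0 (coeff b f) := by
  have h : f * denom R = f - C X * f + C X * (f * X) := by rw [denom]; ring
  simp [h]

theorem coeff_succ_coeff_zero_mul_denom (f : R⟦X⟧⟦X⟧) (a : ℕ) :
    coeff (a + 1) (coeff 0 (f * denom R)) = coeff (a + 1) (coeff 0 f) - coeff a (coeff 0 f) := by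
  have h : f * denom R = f - C X * f + C X * (f * X) := by rw [denom]; ring
  rw [h, map_add, map_sub, coeff_C_mul, coeff_C_mul, coeff_zero_mul_X, mul_zero, add_zero, map_sub,
    coeff_succ_X_mul]

theorem coeff_succ_coeff_succ_mul_denom (f : R⟦X⟧⟦X⟧) (a b : ℕ) :
    coeff (a + 1) (coeff (b + 1) (f * denom R)) = coeff (a + 1) (coeff (b + 1) f) -
      coeff a (coeff (b + 1) f) + coeff a (coeff b f) := by
  have h : f * denom R = f - C X * f + C X * (f * X) := by rw [denom]; ring
  rw [h, map_add, map_sub, coeff_C_mul, coeff_C_mul, coeff_succ_mul_X, map_add, map_sub,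
    coeff_succ_X_mul, coeff_succ_X_mul]

theorem invDenomPow_zero_mul : invDenomPow R 0 * denom R = 1 := by
  ext b a
  rcases a with _ | a
  · rw [coeff_zero_coeff_mul_denom, coeff_coeff_invDenomPow]
    rcases b with _ | b <;> simp [coeff_one]
  · rcases b with _ | b
    · rw [coeff_succ_coeff_zero_mul_denom, coeff_coeff_invDenomPow, coeff_coeff_invDenomPow]
      simp [coeff_one]
    · rw [coeff_succ_coeff_succ_mul_denom, coeff_coeff_invDenomPow, coeff_coeff_invDenomPow,
        coeff_coeff_invDenomPow, Nat.choose_succ_succ]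
      simp [coeff_one]
      ring

/-- Coefficientwise this is Pascal's rule, for C(a, b) and for C(a+k, k). -/
theorem invDenomPow_succ_mul (k : ℕ) : invDenomPow R (k + 1) * denom R = invDenomPow R k := by
  have h (a : ℕ) : (a + 1 + (k + 1)).choose (k + 1) =
      (a + 1 + k).choose k + (a + (k + 1)).choose (k + 1) := by
    rw [← add_assoc (a + 1), Nat.choose_succ_succ, show a + 1 + k = a + (k + 1) by ring]
  ext b a
  rcases a with _ | a
  · simp [coeff_zero_coeff_mul_denom, coeff_coeff_invDenomPow]
  · rcases b with _ | b
    · simp only [coeff_succ_coeff_zero_mul_denom, coeff_coeff_invDenomPow, h,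
        Nat.choose_zero_right]
      push_cast
      ring
    · simp only [coeff_succ_coeff_succ_mul_denom, coeff_coeff_invDenomPow, h,
        Nat.choose_succ_succ a b]
      push_cast
      ring

theorem invDenomPow_mul (k : ℕ) : invDenomPow R k * denom R ^ (k + 1) = 1 := by
  induction k with
  | zero => rw [zero_add, pow_one, invDenomPow_zero_mul]
  | succ k ih => rw [pow_succ', ← mul_assoc, invDenomPow_succ_mul, ih]

/-- The coefficient of `u ^ j` of the closed form, as a power series in `y` whose coefficients are
power series in `q`. -/
noncomputable def closedFamily (x : ℕ → R) (j : ℕ) : R⟦X⟧⟦X⟧ :=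
  C ((mk 1 : R⟦X⟧) ^ j) * geomSubst R (binomBracket K x j)

theorem derivative_C_mul {Λ : Type*} [CommRing Λ] (a : Λ) (f : Λ⟦X⟧) :
    d⁄dX Λ (C a * f) = C a * d⁄dX Λ f := by
  rw [Derivation.leibniz, derivative_C, smul_zero, add_zero, smul_eq_mul]

theorem derivative_closedFamily (x : ℕ → R) (j : ℕ) :
    d⁄dX R⟦X⟧ (closedFamily K x j) = ∑ p ∈ Finset.HasAntidiagonal.antidiagonal j,
      (C X * C (C (x p.1)) * invDenomPow R p.1) * closedFamily K x p.2 := by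
  have hu : IsUnit (denom R) :=
    IsUnit.of_mul_eq_one _ ((mul_comm _ _).trans invDenomPow_zero_mul)
  -- Since 1-q+qy = (1-q)(1+s) and ds/dy = q/(1-q), multiplying by it produces the factor 1+s
  -- required by `derivative_binomBracket`.
  apply hu.mul_left_cancel
  have hι : (C (mk 1) : R⟦X⟧⟦X⟧) * C (1 - X) = 1 := by
    rw [← map_mul, mk_one_mul_one_sub_eq_one, map_one]
  have h1 : denom R * d⁄dX R⟦X⟧ (closedFamily K x j) =
      C X * C (mk 1) ^ j * geomSubst R ((1 + X) * d⁄dX R (binomBracket K x j)) := by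
    rw [closedFamily, derivative_C_mul, derivative_geomSubst, denom_eq, map_mul (geomSubst R), map_pow, map_mul C X]
    linear_combination (C X * C (mk 1) ^ j * geomSubst R (1 + X) *
      geomSubst R (d⁄dX R (binomBracket K x j))) * hι
  rw [h1, derivative_binomBracket, map_sum, Finset.mul_sum, Finset.mul_sum]
  refine Finset.sum_congr rfl fun p hp => ?_
  have hp' : p.1 + p.2 = j := Finset.HasAntidiagonal.mem_antidiagonal.1 hp
  -- The exponents x_0 - j and x_0 - p.2 differ by p.1; the power of 1+s, with p.1 factors 1/(1-q),
  -- is absorbed by `invDenomPow` in `h4`.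
  have h2 : binomBracket K x p.2 =
      (1 + X) ^ p.1 * (binomSeries K (x 0 - j) * bracketSeries K x p.2) := by
    rw [← mul_assoc, one_add_X_pow_mul_binomSeries, binomBracket, ← hp']
    congr 2
    push_cast
    ring
  have h3 : geomSubst R (C (x p.1)) = C (C (x p.1)) := by
    ext1 r
    rw [coeff_geomSubst, coeff_C, coeff_C]
    split_ifs with hr <;> simp [hr]
  have h4 : invDenomPow R p.1 * denom R * geomSubst R (1 + X) ^ p.1 = C (mk 1) ^ p.1 := by
    have h5 : geomSubst R (1 + X) = C (mk 1) * denom R := by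
      rw [denom_eq, ← mul_assoc, hι, one_mul]
    rw [h5, mul_pow]
    have h6 := invDenomPow_mul (R := R) p.1
    rw [pow_succ] at h6
    linear_combination C (mk 1) ^ p.1 * h6
  rw [closedFamily, h2, map_mul (geomSubst R), map_mul (geomSubst R) (_ ^ _), map_pow (geomSubst R),
    map_pow, h3, ← hp', pow_add, ← h4]
  ring

theorem coeff_zero_closedFamily (x : ℕ → R) (j : ℕ) :
    coeff 0 (closedFamily K x j) = if j = 0 then 1 else 0 := by
  rw [closedFamily, coeff_C_mul, coeff_geomSubst, binomBracket,
    coeff_zero_eq_constantCoeff_apply, map_mul constantCoeff]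
  cases j with
  | zero => simp [bracketSeries, expSum_zero, binomSeries, binom_zero]
  | succ j =>
    rw [bracketSeries, constantCoeff_expSum_succ]
    · simp
    · simp

theorem rowFamily_eq_closedFamily (x : ℕ → R) : rowFamily K x = closedFamily K x :=
  eq_of_derivative_eq_sum (powerSeries_mul_natCast_add_one_cancel K)
    (fun k => C X * C (C (x k)) * invDenomPow R k) _ _ (derivative_rowFamily K x)
    (derivative_closedFamily K x) fun j => by
      rw [coeff_zero_rowFamily, coeff_zero_closedFamily]

theorem coeff_rowSum (x : ℕ → R) {n r : ℕ} (hn : 1 ≤ n) (hr : 1 ≤ r) (j : ℕ) :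
    coeff j (coeff r (rowSum K (ascSeries x) n)) =
      (natBinom (n + j - 1) n r : R) * coeff r (binomBracket K x j) := by
  have h : coeff j (coeff r (rowSum K (ascSeries x) n)) = coeff n (coeff r (rowFamily K x j)) := by
    rw [rowFamily, coeff_mk, coeff_mk]
  -- The coefficient needed is that of q^n in q^r (1-q)^(-(j+r)). Positivity of r makes the exponent
  -- j+r a successor, as the negative binomial expansion requires.
  obtain ⟨r, rfl⟩ : ∃ s, r = s + 1 := ⟨r - 1, by omega⟩
  rw [h, rowFamily_eq_closedFamily, closedFamily, coeff_C_mul, coeff_geomSubst, ← mul_assoc,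
    coeff_mul_C, mul_pow, mul_left_comm, ← pow_add, ← add_assoc, mk_one_pow_eq_mk_choose_add,
    coeff_X_pow_mul', natBinom]
  congr 1
  split_ifs with hrn
  · rw [coeff_mk]
    congr 1
    rw [show j + r + (n - (r + 1)) = n + j - 1 by omega,
      ← Nat.choose_symm_of_eq_add (show n + j - 1 = (n - (r + 1)) + (j + r) by omega)]
  · simp

end BinomialSide
end PartitionIdentity
namespace PartitionIdentity

/-! ### Matching both families with the stated sums -/

section Comparison

open PowerSeries

theorem bracket_eq_zero_of_lt {n r : ℕ} (μ : n.Partition) (h : n < r) : bracket μ r = 0 := by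
  rw [bracket, Fintype.card_eq_zero_iff]
  refine ⟨fun ⟨S, hS, _⟩ => ?_⟩
  have hc : Fintype.card (Cell μ) = n := by
    have h2 : (rows μ).sum = n := by
      rw [← Multiset.sum_coe, rows, Multiset.sort_eq, μ.parts_sum]
    rw [Fintype.card_sigma]
    simp only [Fintype.card_fin]
    exact (Fin.sum_univ_getElem _).trans h2
  have := S.card_le_univ
  omega

/-- The substitution X ↦ -X turns (1+X)^i - 1 into -(1 - (1-X)^i), giving one sign per part and one
per chosen cell. -/
theorem coeff_prod_one_sub_one_sub_X_pow {R : Type*} [CommRing R] {n : ℕ} (μ : n.Partition)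
    (r : ℕ) :
    coeff r (μ.parts.map fun i => 1 - (1 - X : R⟦X⟧) ^ i).prod =
      (-1) ^ r * (-1) ^ len μ * (bracket μ r : R) := by
  have h : (μ.parts.map fun i => 1 - (1 - X : R⟦X⟧) ^ i).prod = C ((-1) ^ len μ) *
      rescale (-1) (μ.parts.map fun i => (1 + X : R⟦X⟧) ^ i - 1).prod := by
    have h2 : (C ((-1) ^ len μ) : R⟦X⟧) = (μ.parts.map fun _ => -1).prod := by
      simp [len]
    rw [h2, map_multiset_prod, Multiset.map_map, ← Multiset.prod_map_mul]
    congr 1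
    refine Multiset.map_congr rfl fun i _ => ?_
    simp [sub_eq_add_neg, add_comm]
  rw [h, coeff_C_mul, coeff_rescale, coeff_prod_one_add_X_pow_sub_one]
  ring

variable (K : Type*) [Field K] [CharZero K]

theorem coeff_rowSum_eq_sum {R : Type*} [CommRing R] [Algebra K R] (c : ℕ → R) (n r : ℕ) :
    coeff r (rowSum K c n) = ∑ μ : n.Partition,
      ((-1 : K) ^ ((r : ℤ) - (len μ : ℤ)) * ((bracket μ r : K) / (zee μ : K))) •
        ∏ i ∈ Finset.Icc 1 n, c i ^ mult μ i := by
  rw [rowSum, expSum, map_sum]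
  refine Finset.sum_congr rfl fun μ _ => ?_
  have h1 : coeff r (μ.parts.map fun i => C (c i) * (1 - (1 - X) ^ i)).prod =
      ((-1 : K) ^ r * (-1) ^ len μ * (bracket μ r : K)) • (μ.parts.map c).prod := by
    have h2 : (μ.parts.map fun i => C (c i)).prod = (C (μ.parts.map c).prod : R⟦X⟧) := by
      rw [map_multiset_prod, Multiset.map_map]
      rfl
    rw [Multiset.prod_map_mul, h2, coeff_C_mul, coeff_prod_one_sub_one_sub_X_pow,
      Algebra.smul_def, mul_comm]
    simp
  have h3 : (-1 : K) ^ ((r : ℤ) - (len μ : ℤ)) = (-1) ^ r * (-1) ^ len μ := by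
    rw [zpow_sub₀ (neg_ne_zero.2 one_ne_zero), zpow_natCast, zpow_natCast, div_eq_mul_inv,
      ← inv_pow, inv_neg_one]
  rw [prod_pow_mult, coeff_smul, h1, h3, smul_smul]
  congr 1
  ring

-- Parts are positive, so `x 0` never enters and is free to be z.
omit [CharZero K] in
theorem coeff_bracketSeries (j k : ℕ) (x : ℕ → Coeff K) (hx : ∀ i, 1 ≤ i → x i = xVar K i) :
    coeff k (bracketSeries K x j) = Polynomial.C (P K j k) := by
  rw [bracketSeries, expSum, map_sum, P, map_sum]
  refine Finset.sum_congr rfl fun μ _ => ?_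
  have h2 : (μ.parts.map fun i => C (x i)).prod = (C (μ.parts.map x).prod : (Coeff K)⟦X⟧) := by
    rw [map_multiset_prod, Multiset.map_map]
    rfl
  have h3 : (μ.parts.map x).prod = Polynomial.C (μ.parts.map MvPolynomial.X).prod := by
    rw [map_multiset_prod, Multiset.map_map]
    congr 1
    exact Multiset.map_congr rfl fun i hi => hx i (μ.parts_pos hi)
  rw [coeff_smul, Multiset.prod_map_mul, h2, coeff_C_mul, coeff_prod_one_add_X_pow_sub_one, h3,
    prod_pow_mult, ← Polynomial.smul_C, div_eq_mul_inv, mul_comm (bracket μ k : K), mul_smul,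
    Nat.cast_smul_eq_nsmul, nsmul_eq_mul, mul_comm]

/-- The indeterminate `z` followed by `X_1, X_2, …`. -/
noncomputable def indets (k : ℕ) : Coeff K := if 1 ≤ k then xVar K k else zVar K

theorem rowSeries_eq_ascSeries {i : ℕ} (hi : 1 ≤ i) :
    rowSeries K i = ascSeries (indets K) i := by
  ext1 k
  rw [rowSeries, ascSeries, map_add, coeff_mk, coeff_mk, coeff_C]
  rcases k with _ | k
  · simp [indets]
  · have hk : ((k + 1)! : K) ≠ 0 := Nat.cast_ne_zero.2 (Nat.factorial_ne_zero _)
    rw [if_neg (Nat.succ_ne_zero k), if_pos (Nat.succ_le_succ (Nat.zero_le k)), indets,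
      if_pos (Nat.succ_le_succ (Nat.zero_le k)), zero_add, Nat.ascFactorial_eq_factorial_mul_choose',
      Nat.cast_mul, mul_div_cancel_left₀ _ hk, Nat.cast_smul_eq_nsmul, nsmul_eq_mul,
      show i + (k + 1) - 1 = i - 1 + (k + 1) by omega]

theorem coeff_binomBracket_indets (j r : ℕ) :
    coeff r (binomBracket K (indets K) j) = ∑ k ∈ Finset.range (min r j + 1),
      binom K (zVar K - (j : Coeff K)) (r - k) * Polynomial.C (P K j k) := by
  have h0 : indets K 0 = zVar K := by simp [indets]
  rw [binomBracket, h0, mul_comm, coeff_mul, Finset.Nat.sum_antidiagonal_eq_sum_range_succ_mk]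
  have h1 : ∀ k, coeff k (bracketSeries K (indets K) j) *
      coeff (r - k) (binomSeries K (zVar K - (j : Coeff K))) =
      binom K (zVar K - (j : Coeff K)) (r - k) * Polynomial.C (P K j k) := by
    intro k
    rw [coeff_bracketSeries K j k (indets K) fun i hi => if_pos hi, binomSeries, coeff_mk, mul_comm]
  simp only [h1]
  symm
  refine Finset.sum_subset (fun k hk => ?_) fun k hk hk' => ?_
  · rw [Finset.mem_range] at hk ⊢
    omega
  -- The extra terms have k > j: more cells than the diagram contains.
  · rw [Finset.mem_range] at hk hk'
    have hjk : j < k := by omega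
    simp [P, bracket_eq_zero_of_lt _ hjk]

end Comparison
end PartitionIdentity

theorem mainTheorem1 (K : Type*) [Field K] [CharZero K] (n r : ℕ) (hn : 1 ≤ n) (hr : 1 ≤ r) :
    (∑ μ : n.Partition,
      ((-1 : K) ^ ((r : ℤ) - (PartitionIdentity.len μ : ℤ)) *
          ((PartitionIdentity.bracket μ r : K) / (PartitionIdentity.zee μ : K))) •
        ∏ i ∈ Finset.Icc 1 n,
          PartitionIdentity.rowSeries K i ^ PartitionIdentity.mult μ i) =
    PowerSeries.mk fun j : ℕ =>
      (PartitionIdentity.natBinom (n + j - 1) n r : PartitionIdentity.Coeff K) *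
        ∑ k ∈ Finset.range (min r j + 1),
          PartitionIdentity.binom K
              (PartitionIdentity.zVar K - (j : PartitionIdentity.Coeff K)) (r - k) *
            Polynomial.C (PartitionIdentity.P K j k) := by
  ext1 j
  rw [PowerSeries.coeff_mk, ← PartitionIdentity.coeff_binomBracket_indets,
    ← PartitionIdentity.coeff_rowSum K (PartitionIdentity.indets K) hn hr,
    PartitionIdentity.coeff_rowSum_eq_sum]
  refine congrArg (PowerSeries.coeff j) (Finset.sum_congr rfl fun μ _ => ?_)
  rw [Finset.prod_congr rfl fun i hi => by
    rw [PartitionIdentity.rowSeries_eq_ascSeries K (Finset.mem_Icc.1 hi).1]]
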